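/- Let $k$ be an algebraically closed field of characteristic $p>0$ and let $X$ be a nonsingular irreducible variety over $k$ of dimension $n$ (an integral separated scheme of finite type, smooth of relative dimension $n$ over $k$). Let $F$ be the absolute Frobenius morphism of $X$, put $\omega_X=\Omega^n_{X/k}=\bigwedge^n\Omega_{X/k}$, and let $C:F_*\omega_X\to\omega_X$ be the Cartier operator on top forms. It is additive, it kills exact forms, and $C\bigl(a^p(g_1\cdots g_n)^{p-1}\,dg_1\wedge\cdots\wedge dg_n\bigr)=a\,dg_1\wedge\cdots\wedge dg_n$ for local functions $a,g_1,\dots,g_n$. Let $\sigma\in\operatorname{Hom}_{\mathcal O_X}(F_*\mathcal O_X,\mathcal O_X)$ be a Frobenius splitting of $X$, that is, $\sigma(a^p)=a$ for all local functions $a$. Then there is exactly one section $\bar\sigma\in H^0(X,F_*(\omega_X^{1-p}))$ that corresponds to $\sigma$ under the isomorphism $\operatorname{Hom}_{\mathcal O_X}(F_*\mathcal O_X,\mathcal O_X)\simeq H^0(X,F_*(\omega_X^{1-p}))$, that is, such that $\sigma(f)\,w=C(f\,\bar\sigma\,w^{p})$ for all local functions $f$ and local sections $w$ of $\omega_X$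 (where $\bar\sigma\,w^p$ is the local section of $\omega_X$ obtained by contraction). Moreover, if $Y\subsetneq X$ is a proper closed subscheme that is compatibly split by $\sigma$, that is, $\sigma(F_*\mathcal I_Y)\subseteq\mathcal I_Y$ for the ideal sheaf $\mathcal I_Y$ of $Y$, then $$Y\subset Z(\bar\sigma),$$ where $Z(\bar\sigma)$ is the set of points of $X$ at which $\bar\sigma$, as a section of the line bundle $\omega_X^{1-p}$, vanishes. -/

import Mathlib

open CategoryTheory AlgebraicGeometry
open scoped KaehlerDifferential

universe u

noncomputable section

namespace FrobSplit

/-! ### Commutative algebra: top forms and the Cartier operator -/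

section Algebra

variable (k : Type*) [CommRing k] (A : Type*) [CommRing A] [Algebra k A]

/-- The `A`-module `Ω^n_{A/k} = ⋀^n Ω_{A/k}` of Kähler `n`-forms. -/
abbrev Forms (n : ℕ) : Type _ := ⋀[A]^n Ω[A⁄k]

variable {A} in
/-- The form `dg₁ ∧ ⋯ ∧ dgₙ` (equal to `1` for `n = 0`). -/
def dForm {n : ℕ} (g : Fin n → A) : Forms k A n :=
  exteriorPower.ιMulti A n fun i => KaehlerDifferential.D k A (g i)

/-- The graph of the Cartier operator `C : Ω^n → Ω^n` on top forms (here `n` is the rank of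
`Ω_{A/k}`, so every `n`-form is closed) of a smooth algebra in characteristic `p`.
It is the inverse of the Cartier isomorphism
`Ω^n → Ω^n / dΩ^{n-1}`, `a dg₁ ∧ ⋯ ∧ dgₙ ↦ a^p (g₁⋯gₙ)^{p-1} dg₁ ∧ ⋯ ∧ dgₙ`.
So the graph is the additive subgroup of `Ω^n × Ω^n` generated by the pairs
`(a^p (g₁⋯gₙ)^{p-1} dg₁ ∧ ⋯ ∧ dgₙ, a dg₁ ∧ ⋯ ∧ dgₙ)` and the pairs `(η, 0)` with `η` exact.
The exact `n`-forms are the sums of forms `dg₁ ∧ ⋯ ∧ dgₙ = d(g₁ dg₂ ∧ ⋯ ∧ dgₙ)` if `n ≥ 1`,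
and only `0` if `n = 0`. -/
def cartierGraph (p n : ℕ) : AddSubgroup (Forms k A n × Forms k A n) :=
  AddSubgroup.closure
    ({z | ∃ (a : A) (g : Fin n → A),
        z = ((a ^ p * (∏ i, g i) ^ (p - 1)) • dForm k g, a • dForm k g)} ∪
     {z | 0 < n ∧ ∃ g : Fin n → A, z = (dForm k g, 0)})

variable {A} in
/-- `IsCartier k p η θ` says that `C(η) = θ` for the Cartier operator `C` on `n`-forms. -/
def IsCartier (p : ℕ) {n : ℕ} (η θ : Forms k A n) : Prop :=
  (η, θ) ∈ cartierGraph k A p n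

/-- `ω^{1-p}` for `ω = Ω^n_{A/k}`: the dual of `ω^{⊗(p-1)}`, that is, the module of `A`-multilinear
maps `ω × ⋯ × ω → A` in `p - 1` variables. -/
abbrev PowOneSub (p n : ℕ) : Type _ :=
  MultilinearMap A (fun _ : Fin (p - 1) => Forms k A n) A

variable {k A} in
/-- The form `φ · w^p` in `ω`, for `φ` in `ω^{1-p}` and `w` in `ω`, through the contraction
`ω^{1-p} ⊗ ω^{⊗p} → ω`. -/
def PowOneSub.contract {p n : ℕ} (φ : PowOneSub k A p n) (w : Forms k A n) : Forms k A n :=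
  φ (fun _ => w) • w

end Algebra

/-! ### Frobenius splittings -/

/-- An element of `Hom_{𝒪_X}(F_* 𝒪_X, 𝒪_X)`, with `F` the absolute Frobenius morphism of a
scheme `X` of characteristic `p`. As `F` is the identity on the space and the `p`-th power map
on functions, this is a family of additive maps `σ : 𝒪_X(U) → 𝒪_X(U)`, compatible with
restriction, with `σ(a^p b) = a σ(b)`. -/
@[ext]
structure FrobHom (p : ℕ) (X : Scheme.{u}) where
  app : ∀ U : X.Opens, Γ(X, U) →+ Γ(X, U)
  app_pow_mul : ∀ (U : X.Opens) (a b : Γ(X, U)), app U (a ^ p * b) = a * app U b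
  app_map : ∀ {U V : X.Opens} (h : U ≤ V) (a : Γ(X, V)),
    app U (X.presheaf.map (homOfLE h).op a) = X.presheaf.map (homOfLE h).op (app V a)

/-- `σ` is a Frobenius splitting: the composite `𝒪_X → F_* 𝒪_X → 𝒪_X` is the identity. -/
def FrobHom.IsSplitting {p : ℕ} {X : Scheme.{u}} (σ : FrobHom p X) : Prop :=
  ∀ (U : X.Opens) (a : Γ(X, U)), σ.app U (a ^ p) = a

/-- The closed subscheme `i : Y ⟶ X` is compatibly split under `σ`: `σ(F_* I_Y) ⊆ I_Y` for its
ideal sheaf `I_Y`, the kernel of `𝒪_X → i_* 𝒪_Y`. -/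
def FrobHom.CompatiblySplits {p : ℕ} {X Y : Scheme.{u}} (σ : FrobHom p X) (i : Y ⟶ X) : Prop :=
  ∀ (U : X.Opens) (a : Γ(X, U)), i.app U a = 0 → i.app U (σ.app U a) = 0

/-! ### Sections of `ω_X^{1-p}` -/

section Sections

variable (k : Type u) [Field k] (X : Scheme.{u}) [X.Over (Spec (.of k))]

/-- The local rings of a `k`-scheme are `k`-algebras. -/
instance stalkAlgebra (x : X) : Algebra k (X.presheaf.stalk x) :=
  ((Scheme.ΓSpecIso (.of k)).inv ≫ (X ↘ Spec (.of k)).appTop ≫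
    X.presheaf.germ ⊤ x trivial).hom.toAlgebra

/-- A global section of `ω_X^{1-p}` (equivalently of `F_*(ω_X^{1-p})`), where
`ω_X = ⋀^n Ω_{X/k}` is the canonical sheaf of a smooth `k`-scheme `X` of dimension `n` and
`ω_X^{1-p} = Hom(ω_X^{⊗(p-1)}, 𝒪_X)`.
It is given by its germs `germ x` in `(ω_X^{1-p})_x`, where `ω_{X,x} = ⋀^n Ω_{𝒪_{X,x}/k}`. Such a
family of stalk maps is a sheaf morphism `ω_X^{⊗(p-1)} → 𝒪_X` exactly if it takes local sections
to local sections; it is enough to ask this for tensor products of forms `dg₁ ∧ ⋯ ∧ dgₙ`, as these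
generate `ω_X^{⊗(p-1)}`. -/
@[ext]
structure PowOneSubSection (p n : ℕ) where
  germ : ∀ x : X, PowOneSub k (X.presheaf.stalk x) p n
  regular : ∀ (U : X.Opens) (g : Fin (p - 1) → Fin n → Γ(X, U)),
    ∃ h : Γ(X, U), ∀ (x : X) (hx : x ∈ U),
      germ x (fun j => dForm k fun i => X.presheaf.germ U x hx (g j i)) =
        X.presheaf.germ U x hx h

variable {k X}

/-- The zero set `Z(s)`: the points `x` at which the germ of `s` lies in `𝔪_x (ω_X^{1-p})_x`,
that is, at which `s` is zero in the fibre of `ω_X^{1-p}`. -/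
def PowOneSubSection.zeroSet {p n : ℕ} (s : PowOneSubSection k X p n) : Set X :=
  {x | s.germ x ∈ IsLocalRing.maximalIdeal (X.presheaf.stalk x) •
    (⊤ : Submodule (X.presheaf.stalk x) (PowOneSub k (X.presheaf.stalk x) p n))}

/-- `σ` in `Hom(F_* 𝒪_X, 𝒪_X)` and the section `s` of `F_*(ω_X^{1-p})` correspond to each other
under the isomorphism `Hom(F_* 𝒪_X, 𝒪_X) ≃ F_*(ω_X^{1-p})`: for local functions `f` and
local sections `w` of `ω_X`, `σ(f) w = C(f s w^p)` with `C` the Cartier operator. -/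
def FrobHom.Corresponds {p n : ℕ} (σ : FrobHom p X) (s : PowOneSubSection k X p n) : Prop :=
  ∀ (U : X.Opens) (x : X) (hx : x ∈ U) (f : Γ(X, U)) (w : Forms k (X.presheaf.stalk x) n),
    IsCartier k p (X.presheaf.germ U x hx f • (s.germ x).contract w)
      (X.presheaf.germ U x hx (σ.app U f) • w)

end Sections

end FrobSplit

end

noncomputable section

namespace FrobSplit

open Module

/-! Near each point of `X` there are coordinates: the `dxᵢ` form a basis of the differentials, and
every function is a sum of terms `c^p x^r` with all `rᵢ < p` (`exists_local_coordinates`). On a form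
`f dx₁ ∧ ⋯ ∧ dxₙ` the Cartier operator `C` reads off from `f` the `p`-th root of the coefficient of
`(x₁⋯xₙ)^{p-1}`. Since `IsCartier` is only a relation given by generators, it must be shown that it
is the graph of this function (`isCartier_iff`).

The monomials `x^{p-1-r}` and `x^r` are dual under `(f, c) ↦ C(f c dx)`, so each `σ` is `C(- · c)`
for exactly one function `c` (`cartier_mul_dual`, `eq_of_cartier_mul_eq`), and `c (dx)^{1-p}` is the
germ sought. Its uniqueness makes it independent of the coordinates, hence the germs form a section
(`existsUnique_corresponds`).

If `c` is a unit at a point of `Y`, the ideal `I` of `Y` there is stable under every `C(f · -)`. The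
coefficients of `a ∈ I` in `a = ∑ c_r^p x^r` then lie in `I`, so `I ≤ I * I`
(`le_sq_of_isUnit_dual`). Nakayama gives `I = 0`, so `Y` contains the generic point and is all of
`X` (`isIso_of_stalkMap_injective`). -/

/-- Coordinates `x₁, …, xₙ` on a `k`-algebra `A` of characteristic `p`: the `dxᵢ` form a basis of
`Ω_{A/k}`, and `A` is generated over `A^p` by the monomials in the `xᵢ` with exponents `< p`. -/
structure Coordinates (k : Type*) [CommRing k] (A : Type*) [CommRing A] [Algebra k A]
    (p n : ℕ) where
  x : Fin n → A
  basis : Basis (Fin n) A Ω[A⁄k]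
  basis_apply : ∀ i, basis i = KaehlerDifferential.D k A (x i)
  closure_eq_top : AddSubmonoid.closure
    {a | ∃ (c : A) (r : Fin n → ℕ), (∀ i, r i < p) ∧ a = c ^ p * ∏ i, x i ^ r i} = ⊤

/-! ### Partial derivatives of monomials -/

namespace Coordinates

variable {k : Type*} [CommRing k] {A : Type*} [CommRing A] [Algebra k A] {p n : ℕ}
  (χ : Coordinates k A p n)

/-- The partial derivative `∂/∂xⱼ`. -/
def deriv (j : Fin n) : Derivation k A A :=
  (χ.basis.coord j).compDer (KaehlerDifferential.D k A)

/-- The gradient of a function. -/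
def grad (a : A) (j : Fin n) : A := χ.deriv j a

lemma deriv_x (i j : Fin n) : χ.deriv j (χ.x i) = if i = j then 1 else 0 := by
  simp [deriv, ← χ.basis_apply, Finsupp.single_apply]

lemma D_eq_sum (a : A) :
    KaehlerDifferential.D k A a = ∑ j, χ.deriv j a • χ.basis j := by
  simp [deriv]

lemma grad_add (a b : A) : χ.grad (a + b) = χ.grad a + χ.grad b := by
  ext j; simp [grad]

lemma grad_zero : χ.grad 0 = 0 := by
  ext j; simp [grad]

@[elab_as_elim]
lemma induction {P : A → Prop} (zero : P 0) (add : ∀ a b, P a → P b → P (a + b))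
    (monomial : ∀ (c : A) (r : Fin n → ℕ), (∀ i, r i < p) → P (c ^ p * ∏ i, χ.x i ^ r i))
    (a : A) : P a := by
  have ha : a ∈ AddSubmonoid.closure
      {a | ∃ (c : A) (r : Fin n → ℕ), (∀ i, r i < p) ∧ a = c ^ p * ∏ i, χ.x i ^ r i} := by
    rw [χ.closure_eq_top]; trivial
  induction ha using AddSubmonoid.closure_induction with
  | mem a h => obtain ⟨c, r, hr, rfl⟩ := h; exact monomial c r hr
  | zero => exact zero
  | add a b _ _ ha hb => exact add a b ha hb

/-- Monomials are eigenvectors of `xⱼ ∂ⱼ`; the factor `xⱼ` avoids the truncated exponent `r j - 1`.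
-/
lemma x_mul_deriv_prod (j : Fin n) (s : Finset (Fin n)) (r : Fin n → ℕ) :
    χ.x j * χ.deriv j (∏ i ∈ s, χ.x i ^ r i) =
      if j ∈ s then (r j : A) * ∏ i ∈ s, χ.x i ^ r i else 0 := by
  induction s using Finset.induction with
  | empty => simp
  | insert i s hi ih =>
    have h1 : χ.x j * χ.deriv j (χ.x i ^ r i) = if i = j then (r j : A) * χ.x i ^ r i else 0 := by
      rw [Derivation.leibniz_pow, deriv_x]
      split_ifs with h
      · subst h
        rcases Nat.eq_zero_or_pos (r i) with h0 | h0
        · simp [h0]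
        · obtain ⟨t, ht⟩ := Nat.exists_eq_add_of_lt h0
          rw [ht]; simp; ring
      · simp
    rw [Finset.prod_insert hi, Derivation.leibniz, smul_eq_mul, smul_eq_mul, mul_add,
      mul_left_comm, ih, mul_left_comm (χ.x j), h1]
    by_cases h : i = j
    · subst h; simp [hi]; ring
    · have h' : ¬ j = i := fun e => h e.symm
      simp only [h, h', if_false, Finset.mem_insert, false_or, mul_zero, add_zero]
      split_ifs <;> ring

lemma x_mul_deriv_monomial (j : Fin n) (r : Fin n → ℕ) :
    χ.x j * χ.deriv j (∏ i, χ.x i ^ r i) = (r j : A) * ∏ i, χ.x i ^ r i := by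
  simp [x_mul_deriv_prod]

lemma deriv_prod_of_notMem {j : Fin n} {s : Finset (Fin n)} (hj : j ∉ s) (r : Fin n → ℕ) :
    χ.deriv j (∏ i ∈ s, χ.x i ^ r i) = 0 := by
  induction s using Finset.induction with
  | empty => simp
  | insert i s hi ih =>
    simp only [Finset.mem_insert, not_or] at hj
    rw [Finset.prod_insert hi, Derivation.leibniz, ih hj.2, Derivation.leibniz_pow, deriv_x,
      if_neg (fun e => hj.1 e.symm)]
    simp

lemma iterate_deriv_x_pow_mul (j : Fin n) {u : A} (hu : χ.deriv j u = 0) (r m : ℕ) :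
    (χ.deriv j)^[m] (χ.x j ^ r * u) = (r.descFactorial m : A) * (χ.x j ^ (r - m) * u) := by
  induction m generalizing r with
  | zero => simp
  | succ m ih =>
    rw [Function.iterate_succ_apply', ih, Derivation.leibniz, Derivation.leibniz, hu,
      Derivation.leibniz_pow, deriv_x, Nat.descFactorial_succ, Nat.sub_sub]
    simp
    ring

lemma iterate_deriv_add (j : Fin n) (m : ℕ) (f g : A) :
    (χ.deriv j)^[m] (f + g) = (χ.deriv j)^[m] f + (χ.deriv j)^[m] g := by
  induction m generalizing f g with
  | zero => rfl
  | succ m ih => simp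

/-! ### The Cartier operator on coefficients -/

section CharP

variable [CharP A p]

lemma deriv_pow_mul (j : Fin n) (c f : A) : χ.deriv j (c ^ p * f) = c ^ p * χ.deriv j f := by
  rw [Derivation.leibniz, Derivation.leibniz_pow]
  simp

lemma grad_pow_mul (c f : A) : χ.grad (c ^ p * f) = c ^ p • χ.grad f := by
  ext j; simp [grad]

lemma iterate_deriv_pow_mul (j : Fin n) (c f : A) (m : ℕ) :
    (χ.deriv j)^[m] (c ^ p * f) = c ^ p * (χ.deriv j)^[m] f := by
  induction m generalizing f with
  | zero => rfl
  | succ m ih => rw [Function.iterate_succ_apply, deriv_pow_mul, ih, Function.iterate_succ_apply]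

variable [Fact p.Prime]

/-- Composing the operators `-∂ⱼ^{p-1}` extracts the coefficient of a monomial without first knowing
that the monomials are independent over `A^p`. Each kills `xⱼ^r` for `r < p - 1` and sends
`xⱼ^{p-1}` to `-(p-1)! = 1`, by Wilson's theorem. -/
lemma exists_leading_operator (s : Finset (Fin n)) :
    ∃ T : A →+ A, (∀ c f, T (c ^ p * f) = c ^ p * T f) ∧
      ∀ r : Fin n → ℕ, (∀ i, r i < p) → T (∏ i, χ.x i ^ r i) =
        if ∀ i ∈ s, r i = p - 1 then ∏ i ∈ sᶜ, χ.x i ^ r i else 0 := by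
  have hp : p.Prime := Fact.out
  induction s using Finset.induction with
  | empty => exact ⟨.id A, fun _ _ => rfl, fun r _ => by simp⟩
  | insert j s hj ih =>
    obtain ⟨T, hT, hT'⟩ := ih
    refine ⟨⟨⟨fun f => -(χ.deriv j)^[p - 1] (T f), ?_⟩, ?_⟩, ?_, ?_⟩
    · simp [iterate_map_zero]
    · intro f g
      simp only [map_add, iterate_deriv_add]; ring
    · intro c f
      simp [hT, iterate_deriv_pow_mul]
    · intro r hr
      simp only [AddMonoidHom.coe_mk, ZeroHom.coe_mk]
      rw [hT' r hr]
      by_cases h : ∀ i ∈ s, r i = p - 1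
      · have hs : sᶜ = insert j (insert j s)ᶜ := by
          ext i; by_cases h : i = j <;> simp [h, hj]
        rw [if_pos h, hs, Finset.prod_insert (by simp), iterate_deriv_x_pow_mul]
        · by_cases h1 : r j = p - 1
          · rw [if_pos (by simpa [h1] using h), h1, Nat.descFactorial_self]
            have hw : (((p - 1).factorial : ℕ) : A) = -1 := by
              have := congrArg (ZMod.castHom dvd_rfl A) (ZMod.wilsons_lemma p)
              rw [map_natCast] at this
              simpa using this
            rw [hw]; simp
          · rw [if_neg (by simp [h1]), Nat.descFactorial_of_lt (by have := hr j; omega)]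
            simp
        · exact χ.deriv_prod_of_notMem (by simp) r
      · rw [if_neg h, if_neg fun h' => h fun i hi => h' i (Finset.mem_insert_of_mem hi)]
        simp [iterate_map_zero]

variable [IsDomain A]

/-- The leading operator for all variables takes values in `A^p`; since Frobenius is injective on a
domain, its unique `p`-th root is additive. -/
lemma exists_cartier : ∃ C : A →+ A, (∀ c f, C (c ^ p * f) = c * C f) ∧
    ∀ r : Fin n → ℕ, (∀ i, r i < p) → C (∏ i, χ.x i ^ r i) =
      if ∀ i, r i = p - 1 then 1 else 0 := by
  have hp : p.Prime := Fact.out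
  obtain ⟨T, hT, hT'⟩ := χ.exists_leading_operator Finset.univ
  have hinj : Function.Injective fun a : A => a ^ p := frobenius_inj A p
  have key : ∀ f, ∃ c, c ^ p = T f := by
    intro f
    induction f using χ.induction with
    | zero => exact ⟨0, by simp [hp.ne_zero]⟩
    | add a b ha hb =>
      obtain ⟨c, hc⟩ := ha
      obtain ⟨d, hd⟩ := hb
      exact ⟨c + d, by rw [add_pow_char, hc, hd, map_add]⟩
    | monomial c r hr =>
      rw [hT, hT' r hr]
      split_ifs
      · exact ⟨c, by simp⟩
      · exact ⟨0, by simp [hp.ne_zero]⟩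
  choose C hC using key
  refine ⟨AddMonoidHom.mk' C ?_, ?_, ?_⟩
  · intro f g
    apply hinj
    simp only [hC, add_pow_char, map_add]
  · intro c f
    apply hinj
    simp only [AddMonoidHom.mk'_apply, hC, hT, mul_pow]
  · intro r hr
    apply hinj
    simp only [AddMonoidHom.mk'_apply, hC, hT' r hr]
    split_ifs with h1 h2 h2
    · simp
    · exact absurd (fun i => h1 i (Finset.mem_univ i)) h2
    · exact absurd (fun i _ => h2 i) h1
    · simp [hp.ne_zero]

/-- The Cartier operator in coordinates: `C(f dx₁ ∧ ⋯ ∧ dxₙ) = χ.cartier f dx₁ ∧ ⋯ ∧ dxₙ`. -/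
def cartier : A →+ A := χ.exists_cartier.choose

lemma cartier_pow_mul (c f : A) : χ.cartier (c ^ p * f) = c * χ.cartier f :=
  χ.exists_cartier.choose_spec.1 c f

lemma cartier_monomial_of_lt {r : Fin n → ℕ} (hr : ∀ i, r i < p) :
    χ.cartier (∏ i, χ.x i ^ r i) = if ∀ i, r i = p - 1 then 1 else 0 :=
  χ.exists_cartier.choose_spec.2 r hr

lemma cartier_monomial (m : Fin n → ℕ) :
    χ.cartier (∏ i, χ.x i ^ m i) =
      if ∀ i, m i % p = p - 1 then ∏ i, χ.x i ^ (m i / p) else 0 := by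
  have hp : p.Prime := Fact.out
  have : ∏ i, χ.x i ^ m i = (∏ i, χ.x i ^ (m i / p)) ^ p * ∏ i, χ.x i ^ (m i % p) := by
    rw [← Finset.prod_pow, ← Finset.prod_mul_distrib]
    refine Finset.prod_congr rfl fun i _ => ?_
    rw [← pow_mul, ← pow_add, mul_comm, Nat.div_add_mod]
  rw [this, cartier_pow_mul, cartier_monomial_of_lt _ fun i => Nat.mod_lt _ hp.pos]
  simp

end CharP

end Coordinates

end FrobSplit

/-! ### Exact forms are killed by the Cartier operator -/

/-- A multilinear map that vanishes on all families of generators vanishes on all families taken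
from the generated additive submonoids. -/
lemma MultilinearMap.eq_zero_of_mem_closure {R ι M N : Type*} [Finite ι] [Semiring R]
    [AddCommMonoid M] [AddCommMonoid N] [Module R M] [Module R N]
    (f : MultilinearMap R (fun _ : ι => M) N) (G : ι → Set M)
    (h : ∀ v : ι → M, (∀ i, v i ∈ G i) → f v = 0) (v : ι → M)
    (hv : ∀ i, v i ∈ AddSubmonoid.closure (G i)) : f v = 0 := by
  classical
  have := Fintype.ofFinite ι
  suffices H : ∀ s : Finset ι, ∀ v : ι → M, (∀ i ∈ s, v i ∈ AddSubmonoid.closure (G i)) →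
      (∀ i ∉ s, v i ∈ G i) → f v = 0 from H Finset.univ v (fun i _ => hv i) (by simp)
  intro s
  induction s using Finset.induction with
  | empty => exact fun v _ hv => h v fun i => hv i (by simp)
  | insert j s hj ih =>
    intro v hv hv'
    have key : ∀ a ∈ AddSubmonoid.closure (G j), f (Function.update v j a) = 0 := by
      intro a ha
      induction ha using AddSubmonoid.closure_induction with
      | mem a ha =>
        refine ih _ (fun i hi => ?_) fun i hi => ?_
        · rw [Function.update_of_ne (ne_of_mem_of_not_mem hi hj)]
          exact hv i (Finset.mem_insert_of_mem hi)
        · by_cases e : i = j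
          · subst e; simpa using ha
          · rw [Function.update_of_ne e]
            exact hv' i (by simp [e, hi])
      | zero => exact f.map_update_zero v j
      | add a b _ _ ha hb => rw [f.map_update_add, ha, hb, add_zero]
    simpa using key (v j) (hv j (Finset.mem_insert_self j s))

namespace FrobSplit

open Module

namespace Coordinates

variable {k : Type*} [CommRing k] {A : Type*} [CommRing A] [Algebra k A] {p n : ℕ}
  (χ : Coordinates k A p n)

/-- The generators of the group of exact `1`-forms, written in the basis `dx₁, …, dxₙ`. -/
def exactGenerators : Set (Fin n → A) :=
  {v | ∃ (c : A) (r : Fin n → ℕ), v = c ^ p • χ.grad (∏ i, χ.x i ^ r i)}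

/-- The forms `(c xⱼ)^p dlog xⱼ`, written in the basis `dx₁, …, dxₙ`. -/
def logGenerators : Set (Fin n → A) :=
  {v | ∃ (c : A) (j : Fin n), v = Pi.single j (c ^ p * χ.x j ^ (p - 1))}

lemma x_ne_zero [Nontrivial A] (i : Fin n) : χ.x i ≠ 0 := by
  intro h
  have := χ.basis.ne_zero i
  rw [χ.basis_apply, h, map_zero] at this
  exact this rfl

variable [CharP A p]

lemma grad_mem_closure (a : A) : χ.grad a ∈ AddSubmonoid.closure χ.exactGenerators := by
  induction a using χ.induction with
  | zero => rw [grad_zero]; exact zero_mem _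
  | add a b ha hb => rw [grad_add]; exact add_mem ha hb
  | monomial c r hr =>
    rw [grad_pow_mul]; exact AddSubmonoid.subset_closure ⟨c, r, rfl⟩

variable [Fact p.Prime] [IsDomain A]

lemma cartier_intCast_mul (d : ℤ) (f : A) : χ.cartier (d * f) = d * χ.cartier f := by
  rw [← zsmul_eq_mul, map_zsmul, zsmul_eq_mul]

/-- The determinant of forms `cᵢ^p x^{γᵢ} ∑ⱼ mᵢⱼ dlog xⱼ`, some of which are exact
because `mᵢ = γᵢ`, is killed by the Cartier operator. -/
lemma cartier_det_of_log (M : Matrix (Fin n) (Fin n) A) (S : Finset (Fin n)) (hS : S.Nonempty)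
    (c : Fin n → A) (m γ : Fin n → Fin n → ℕ)
    (hM : ∀ i j, χ.x j * M i j = c i ^ p * (m i j : A) * ∏ l, χ.x l ^ γ i l)
    (hmem : ∀ i ∈ S, m i = γ i) (hnotMem : ∀ i ∉ S, γ i = 0) :
    χ.cartier M.det = 0 := by
  have hp : p.Prime := Fact.out
  set P : A := ∏ j, χ.x j with hP
  have hP0 : P ≠ 0 := Finset.prod_ne_zero_iff.mpr fun j _ => χ.x_ne_zero j
  set d : ℤ := Matrix.det (Matrix.of fun i j => (m i j : ℤ)) with hd
  have hdet : (d : A) = Matrix.det (Matrix.of fun i j => (m i j : A)) := by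
    rw [hd, Int.cast_det]
    congr 1
    ext i j
    simp
  have h1 : P * M.det = (∏ i, c i ^ p * ∏ l, χ.x l ^ γ i l) * d := by
    rw [hdet, hP, ← Matrix.det_mul_row, ← Matrix.det_mul_column]
    congr 1
    ext i j
    simp only [Matrix.of_apply, hM]
    ring
  -- One factor `P` turns each `dxⱼ` into `dlog xⱼ`; the other `p - 1` complete a `p`-th power that
  -- the Cartier operator can pull out.
  have h2 : P ^ p * M.det =
      (∏ i, c i) ^ p * (d * ∏ l, χ.x l ^ (p - 1 + ∑ i, γ i l)) := by
    have : ∏ l, χ.x l ^ (p - 1 + ∑ i, γ i l) = P ^ (p - 1) * ∏ i, ∏ l, χ.x l ^ γ i l := by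
      rw [Finset.prod_comm, hP, ← Finset.prod_pow, ← Finset.prod_mul_distrib]
      simp [pow_add, Finset.prod_pow_eq_pow_sum]
    rw [Finset.prod_mul_distrib, Finset.prod_pow] at h1
    have hPp : P ^ p = P ^ (p - 1) * P := by rw [← pow_succ, Nat.sub_add_cancel hp.pos]
    rw [this, hPp, mul_assoc, h1]
    ring
  have h3 : P * χ.cartier M.det = 0 := by
    rw [← cartier_pow_mul, h2, cartier_pow_mul, cartier_intCast_mul]
    by_cases hd0 : (d : A) = 0
    · simp [hd0]
    · rw [cartier_monomial, if_neg]
      · simp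
      intro hall
      have hdvd : ∀ l, p ∣ ∑ i, γ i l := by
        intro l
        have h := hall l
        have h' : (p - 1 + ∑ i, γ i l) ≡ p - 1 + 0 [MOD p] := by
          rw [Nat.ModEq, h, add_zero, Nat.mod_eq_of_lt (by have := hp.pos; omega)]
        exact (Nat.modEq_zero_iff_dvd).mp (Nat.ModEq.add_left_cancel' _ h')
      rw [hdet] at hd0
      -- If the monomial survived, the columns of `γ` would sum to zero mod `p`. As `γ = m` on rows
      -- in `S` and `γ = 0` elsewhere, the indicator vector of `S` would then annihilate a matrix
      -- with nonzero determinant.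
      have hv := Matrix.eq_zero_of_vecMul_eq_zero hd0 (v := fun i => if i ∈ S then 1 else 0) (by
        ext l
        simp only [Matrix.vecMul, dotProduct, Matrix.of_apply, ite_mul, one_mul, zero_mul,
          Pi.zero_apply, ← Finset.sum_filter]
        rw [← (CharP.cast_eq_zero_iff A p _).mpr (hdvd l), Nat.cast_sum,
          ← Finset.sum_filter_add_sum_filter_not Finset.univ (· ∈ S) fun i => (γ i l : A)]
        rw [Finset.sum_congr rfl fun i hi => by rw [hmem i (Finset.mem_filter.mp hi).2],
          Finset.sum_eq_zero (s := Finset.univ.filter (· ∉ S)) fun i hi => by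
            rw [hnotMem i (Finset.mem_filter.mp hi).2]; simp, add_zero])
      obtain ⟨i, hi⟩ := hS
      simpa [hi] using congrFun hv i
  exact (mul_eq_zero.mp h3).resolve_left hP0

/-- `f ↦ C(f dx₁ ∧ ⋯ ∧ dxₙ)` applied to the wedge product of `n` one-forms. -/
def cartierDet : MultilinearMap ℤ (fun _ : Fin n => Fin n → A) A :=
  χ.cartier.toIntLinearMap.compMultilinearMap
    (Matrix.detRowAlternating.toMultilinearMap.restrictScalars ℤ)

lemma cartierDet_apply (v : Fin n → Fin n → A) :
    χ.cartierDet v = χ.cartier (Matrix.det (Matrix.of v)) := rfl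

lemma cartierDet_eq_zero (S : Finset (Fin n)) (hS : S.Nonempty) (v : Fin n → Fin n → A)
    (hmem : ∀ i ∈ S, v i ∈ AddSubmonoid.closure χ.exactGenerators)
    (hnotMem : ∀ i ∉ S, v i ∈ AddSubmonoid.closure χ.logGenerators) :
    χ.cartierDet v = 0 := by
  have hp : p.Prime := Fact.out
  refine χ.cartierDet.eq_zero_of_mem_closure
    (fun i => if i ∈ S then χ.exactGenerators else χ.logGenerators) (fun v hv => ?_) v fun i => ?_
  · have : ∀ i, ∃ (c : A) (m γ : Fin n → ℕ),
        (∀ j, χ.x j * v i j = c ^ p * (m j : A) * ∏ l, χ.x l ^ γ l) ∧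
        (i ∈ S → m = γ) ∧ (i ∉ S → γ = 0) := by
      intro i
      have hvi := hv i
      by_cases hi : i ∈ S
      · rw [if_pos hi] at hvi
        obtain ⟨c, r, h⟩ := hvi
        refine ⟨c, r, r, fun j => ?_, fun _ => rfl, fun h => absurd hi h⟩
        rw [h, Pi.smul_apply, smul_eq_mul, mul_left_comm, grad, x_mul_deriv_monomial, mul_assoc]
      · rw [if_neg hi] at hvi
        obtain ⟨c, l, h⟩ := hvi
        -- `c^p xₗ^{p-1} dxₗ = (c xₗ)^p dlog xₗ`.
        refine ⟨c * χ.x l, Pi.single l 1, 0, fun j => ?_, fun h => absurd h hi, fun _ => rfl⟩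
        rw [h]
        by_cases hj : j = l
        · subst hj
          have : χ.x j ^ p = χ.x j ^ (p - 1) * χ.x j := by
            rw [← pow_succ, Nat.sub_add_cancel hp.pos]
          simp [mul_pow, this]; ring
        · simp [hj]
    choose c m γ h1 h2 h3 using this
    rw [cartierDet_apply]
    exact χ.cartier_det_of_log _ S hS c m γ h1 h2 h3
  · by_cases hi : i ∈ S
    · simpa [hi] using hmem i hi
    · simpa [hi] using hnotMem i hi

lemma cartier_det_grad (hn : 0 < n) (g : Fin n → A) :
    χ.cartier (Matrix.det (Matrix.of fun i => χ.grad (g i))) = 0 := by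
  rw [← cartierDet_apply]
  exact χ.cartierDet_eq_zero Finset.univ ⟨⟨0, hn⟩, Finset.mem_univ _⟩ _
    (fun i _ => χ.grad_mem_closure _) (by simp)

end Coordinates

end FrobSplit

/-! ### The Cartier operator on logarithmic forms -/

/-- `(g + h)^{p-1} d(g + h) - g^{p-1} dg - h^{p-1} dh` is exact in characteristic `p`. -/
lemma Derivation.exists_add_pow_mul_map_add {R A : Type*} [CommRing R] [CommRing A] [Algebra R A]
    (p : ℕ) (hp : p.Prime) (g h : A) :
    ∃ q : A, ∀ D : Derivation R A A, (g + h) ^ (p - 1) * D (g + h) =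
      g ^ (p - 1) * D g + h ^ (p - 1) * D h + D q := by
  obtain ⟨N, rfl⟩ : ∃ N, p = N + 1 := ⟨p - 1, (Nat.sub_add_cancel hp.pos).symm⟩
  have hdvd : ∀ i ∈ Finset.range N, (N + 1) ∣ (N + 1).choose (i + 1) := fun i hi =>
    hp.dvd_choose_self (Nat.succ_ne_zero i) (by have := Finset.mem_range.mp hi; omega)
  have hc1 : ∀ i ∈ Finset.range N, ((N + 1).choose (i + 1) / (N + 1)) * (i + 1) = N.choose i := by
    intro i hi
    apply Nat.eq_of_mul_eq_mul_left hp.pos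
    rw [← mul_assoc, Nat.mul_div_cancel' (hdvd i hi)]
    exact (Nat.add_one_mul_choose_eq N i).symm
  have hc2 : ∀ i ∈ Finset.range N,
      ((N + 1).choose (i + 1) / (N + 1)) * (N - i) = N.choose (i + 1) := by
    intro i hi
    apply Nat.eq_of_mul_eq_mul_left hp.pos
    rw [← mul_assoc, Nat.mul_div_cancel' (hdvd i hi), mul_comm (N + 1), Nat.choose_mul_succ_eq]
    congr 1
    omega
  -- The witness is `((g + h)^p - g^p - h^p) / p`, with the division made in the binomial
  -- coefficients.
  refine ⟨∑ i ∈ Finset.range N,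
    (((N + 1).choose (i + 1) / (N + 1) : ℕ) : A) * (g ^ (i + 1) * h ^ (N - i)), fun D => ?_⟩
  have e1 : (g + h) ^ N = ∑ i ∈ Finset.range N, (N.choose i : A) * (g ^ i * h ^ (N - i)) + g ^ N := by
    rw [add_pow, Finset.sum_range_succ]
    simp [mul_comm]
  have e2 : (g + h) ^ N =
      ∑ i ∈ Finset.range N, (N.choose (i + 1) : A) * (g ^ (i + 1) * h ^ (N - i - 1)) + h ^ N := by
    rw [add_pow, Finset.sum_range_succ']
    simp [mul_comm, Nat.sub_sub]
  have e3 : D (∑ i ∈ Finset.range N,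
      (((N + 1).choose (i + 1) / (N + 1) : ℕ) : A) * (g ^ (i + 1) * h ^ (N - i))) =
      (∑ i ∈ Finset.range N, (N.choose i : A) * (g ^ i * h ^ (N - i))) * D g +
      (∑ i ∈ Finset.range N, (N.choose (i + 1) : A) * (g ^ (i + 1) * h ^ (N - i - 1))) * D h := by
    rw [map_sum, Finset.sum_mul, Finset.sum_mul, ← Finset.sum_add_distrib]
    refine Finset.sum_congr rfl fun i hi => ?_
    rw [← hc1 i hi, ← hc2 i hi]
    simp only [Derivation.leibniz, Derivation.leibniz_pow, Derivation.map_natCast, smul_eq_mul,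
      nsmul_eq_mul, Nat.cast_mul, Nat.add_sub_cancel]
    ring
  rw [e3, Nat.add_sub_cancel, map_add]
  linear_combination (D g) * e1 + (D h) * e2

namespace FrobSplit

open Module

namespace Coordinates

variable {k : Type*} [CommRing k] {A : Type*} [CommRing A] [Algebra k A] {p n : ℕ}
  (χ : Coordinates k A p n) [CharP A p] [Fact p.Prime] [IsDomain A]

/-- `g^{p-1} dg = ∑ⱼ (∂ⱼg)^p xⱼ^{p-1} dxⱼ` up to an exact form. -/
lemma pow_smul_grad (g : A) : ∃ e ∈ AddSubmonoid.closure χ.exactGenerators,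
    g ^ (p - 1) • χ.grad g = e + fun j => χ.grad g j ^ p * χ.x j ^ (p - 1) := by
  have hp : p.Prime := Fact.out
  induction g using χ.induction with
  | zero => exact ⟨0, zero_mem _, by ext; simp [grad_zero, hp.ne_zero]⟩
  | add g h hg hh =>
    obtain ⟨e, he, hg⟩ := hg
    obtain ⟨e', he', hh⟩ := hh
    obtain ⟨q, hq⟩ := Derivation.exists_add_pow_mul_map_add (R := k) p hp g h
    refine ⟨e + e' + χ.grad q, add_mem (add_mem he he') (χ.grad_mem_closure q), ?_⟩
    ext j
    have h1 := congrFun hg j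
    have h2 := congrFun hh j
    have h3 := hq (χ.deriv j)
    simp only [grad_add, Pi.add_apply, Pi.smul_apply, smul_eq_mul, add_pow_char] at h1 h2 ⊢
    simp only [grad, map_add] at h1 h2 h3 ⊢
    linear_combination h1 + h2 + h3
  | monomial c r hr =>
    refine ⟨0, zero_mem _, ?_⟩
    ext j
    have h1 := χ.x_mul_deriv_monomial j r
    set R := ∏ i, χ.x i ^ r i
    apply mul_left_cancel₀ (χ.x_ne_zero j)
    have hx : χ.x j ^ p = χ.x j ^ (p - 1) * χ.x j := by
      rw [← pow_succ, Nat.sub_add_cancel hp.pos]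
    have hR : (c ^ p * R) ^ p = (c ^ p * R) ^ (p - 1) * (c ^ p * R) := by
      rw [← pow_succ, Nat.sub_add_cancel hp.pos]
    -- Frobenius fixes the prime field, so both sides below equal `r j` times the same `p`-th power.
    have hr : ((r j : A)) ^ p = r j := by
      rw [← frobenius_def, map_natCast]
    have e1 : χ.x j * ((c ^ p * R) ^ (p - 1) * (c ^ p * χ.deriv j R)) = (c ^ p * R) ^ p * r j := by
      rw [hR]; linear_combination (c ^ p * R) ^ (p - 1) * c ^ p * h1
    have e2 : χ.x j * ((c ^ p * χ.deriv j R) ^ p * χ.x j ^ (p - 1)) = (c ^ p * R) ^ p * r j := by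
      calc _ = (c ^ p * (χ.x j * χ.deriv j R)) ^ p := by rw [mul_pow, mul_pow, mul_pow, hx]; ring
        _ = _ := by rw [h1, ← mul_assoc, mul_right_comm, mul_pow _ (r j : A), hr]
    simpa [grad_pow_mul, grad] using e1.trans e2.symm

/-- Replace each `gᵢ^{p-1} dgᵢ` by an exact form plus `∑ⱼ (∂ⱼgᵢ)^p xⱼ^{p-1} dxⱼ` and expand the
wedge product. Terms with an exact factor die; the remaining one is the `p`-th power of the Jacobian
times `(x₁⋯xₙ)^{p-1}`. -/
lemma cartier_log_det (a : A) (g : Fin n → A) :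
    χ.cartier (a ^ p * (∏ i, g i) ^ (p - 1) * Matrix.det (Matrix.of fun i => χ.grad (g i))) =
      a * Matrix.det (Matrix.of fun i => χ.grad (g i)) := by
  have hp : p.Prime := Fact.out
  choose e he hge using fun i => χ.pow_smul_grad (g i)
  have hdet : (∏ i, g i) ^ (p - 1) * Matrix.det (Matrix.of fun i => χ.grad (g i)) =
      Matrix.det (Matrix.of fun i => g i ^ (p - 1) • χ.grad (g i)) := by
    rw [← Finset.prod_pow]
    exact (Matrix.det_mul_column _ _).symm
  rw [mul_assoc, cartier_pow_mul, hdet, ← cartierDet_apply]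
  congr 1
  have hsum : (fun i => g i ^ (p - 1) • χ.grad (g i)) =
      e + fun i j => χ.grad (g i) j ^ p * χ.x j ^ (p - 1) := funext hge
  rw [hsum, MultilinearMap.map_add_univ, Finset.sum_eq_single ∅]
  · rw [Finset.piecewise_empty, cartierDet_apply]
    have : Matrix.det (Matrix.of fun i j => χ.grad (g i) j ^ p * χ.x j ^ (p - 1)) =
        (Matrix.det (Matrix.of fun i => χ.grad (g i))) ^ p * ∏ j, χ.x j ^ (p - 1) := by
      rw [← frobenius_def, RingHom.map_det, mul_comm, ← Matrix.det_mul_row]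
      congr 1
      ext i j
      simp [frobenius_def, mul_comm]
    rw [this, cartier_pow_mul, cartier_monomial_of_lt _ fun _ => by have := hp.pos; omega]
    simp
  · intro S _ hS
    refine χ.cartierDet_eq_zero S (Finset.nonempty_iff_ne_empty.mpr hS) _ (fun i hi => ?_)
      fun i hi => ?_
    · rw [Finset.piecewise_eq_of_mem _ _ _ hi]; exact he i
    · rw [Finset.piecewise_eq_of_notMem _ _ _ hi]
      have : (fun j => χ.grad (g i) j ^ p * χ.x j ^ (p - 1)) =
          ∑ j, Pi.single j (χ.grad (g i) j ^ p * χ.x j ^ (p - 1)) :=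
        (Finset.univ_sum_single _).symm
      rw [this]
      exact sum_mem fun j _ => AddSubmonoid.subset_closure ⟨_, j, rfl⟩
  · simp

end Coordinates

end FrobSplit

/-! ### Top forms in coordinates and the duality pairing -/

namespace FrobSplit

open Module

namespace Coordinates

variable {k : Type*} [CommRing k] {A : Type*} [CommRing A] [Algebra k A] {p n : ℕ}
  (χ : Coordinates k A p n)

/-- The coefficient `f` of a form `f dx₁ ∧ ⋯ ∧ dxₙ`. -/
def coeff : Forms k A n →ₗ[A] A := exteriorPower.alternatingMapLinearEquiv χ.basis.det

lemma coeff_dForm (g : Fin n → A) :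
    χ.coeff (dForm k g) = Matrix.det (Matrix.of fun i => χ.grad (g i)) := by
  rw [coeff, dForm, exteriorPower.alternatingMapLinearEquiv_apply_ιMulti, Basis.det_apply,
    ← Matrix.det_transpose]
  congr 1

lemma coeff_dForm_x : χ.coeff (dForm k χ.x) = 1 := by
  have : dForm k χ.x = exteriorPower.ιMulti A n χ.basis := by
    rw [dForm]; congr 1; ext i; rw [χ.basis_apply]
  rw [this, coeff, exteriorPower.alternatingMapLinearEquiv_apply_ιMulti, Basis.det_self]

lemma coeff_smul_dForm (w : Forms k A n) : χ.coeff w • dForm k χ.x = w := by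
  suffices h : (χ.coeff.smulRight (dForm k χ.x)) = LinearMap.id from LinearMap.congr_fun h w
  apply exteriorPower.linearMap_ext
  refine Basis.ext_alternating χ.basis fun v hv => ?_
  obtain ⟨σ, rfl⟩ : ∃ σ : Equiv.Perm (Fin n), v = σ :=
    ⟨Equiv.ofBijective v (Finite.injective_iff_bijective.mp hv), rfl⟩
  have hx : exteriorPower.ιMulti A n χ.basis = dForm k χ.x := by
    rw [dForm]; congr 1; ext i; rw [χ.basis_apply]
  have hσ : (fun i => χ.basis (σ i)) = χ.basis ∘ σ := rfl
  simp only [LinearMap.compAlternatingMap_apply, LinearMap.smulRight_apply, LinearMap.id_apply, hσ,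
    AlternatingMap.map_perm, hx, coeff_dForm_x]
  simp [Units.smul_def]

lemma coeff_injective : Function.Injective χ.coeff := fun v w h => by
  rw [← χ.coeff_smul_dForm v, h, coeff_smul_dForm]

lemma coeff_dForm_update (i : Fin n) (h : A) :
    χ.coeff (dForm k (Function.update χ.x i h)) = χ.deriv i h := by
  have : dForm k (Function.update χ.x i h) =
      exteriorPower.ιMulti A n (Function.update χ.basis i (KaehlerDifferential.D k A h)) := by
    rw [dForm]; congr 1; ext j
    by_cases hj : j = i
    · subst hj; simp
    · simp [hj, χ.basis_apply]
  rw [this, coeff, exteriorPower.alternatingMapLinearEquiv_apply_ιMulti, Basis.det_apply,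
    Basis.toMatrix_update, Basis.toMatrix_self, ← Matrix.cramer_apply, Matrix.cramer_one]
  simp [deriv]

variable [CharP A p] [Fact p.Prime] [IsDomain A]

/-- The Cartier operator is well defined, and given in coordinates by `χ.cartier`. -/
lemma coeff_eq_of_isCartier {η θ : Forms k A n} (h : IsCartier k p η θ) :
    χ.coeff θ = χ.cartier (χ.coeff η) := by
  rw [IsCartier] at h
  generalize hz : (η, θ) = z at h
  have hη : η = z.1 := by rw [← hz]
  have hθ : θ = z.2 := by rw [← hz]
  subst hη hθ
  clear hz
  induction h using AddSubgroup.closure_induction with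
  | mem z hz =>
    rcases hz with ⟨a, g, rfl⟩ | ⟨hn, g, rfl⟩
    · simp [coeff_dForm, cartier_log_det]
    · simp [coeff_dForm, cartier_det_grad _ hn]
  | zero => simp
  | add x y _ _ hx hy => simp [hx, hy]
  | neg x _ hx => simp [hx]

/-- The relation is total: `x^r dx₁ ∧ ⋯ ∧ dxₙ` is a logarithmic generator when all `rᵢ = p - 1`, and
otherwise has a primitive in a variable with `rᵢ + 1` invertible mod `p`. -/
lemma isCartier_smul_dForm (f : A) :
    IsCartier k p (f • dForm k χ.x) (χ.cartier f • dForm k χ.x) := by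
  have hp : p.Prime := Fact.out
  rw [IsCartier]
  induction f using χ.induction with
  | zero => rw [map_zero, zero_smul]; exact zero_mem _
  | add f g hf hg => simpa [add_smul] using add_mem hf hg
  | monomial c r hr =>
    rw [cartier_pow_mul, cartier_monomial_of_lt _ hr]
    split_ifs with h
    · refine AddSubgroup.subset_closure (Or.inl ⟨c, χ.x, ?_⟩)
      simp [h, Finset.prod_pow]
    · push Not at h
      obtain ⟨i, hi⟩ := h
      have hlt : r i + 1 < p := by have := hr i; omega
      -- The inverse of `rᵢ + 1` is taken as a natural number so that derivations kill it.
      obtain ⟨t, ht⟩ : ∃ t : ℕ, ((r i + 1 : ℕ) : A) * t = 1 := by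
        have hne : ((r i + 1 : ℕ) : ZMod p) ≠ 0 := fun h0 =>
          absurd (Nat.le_of_dvd (Nat.succ_pos _) ((ZMod.natCast_eq_zero_iff _ _).mp h0))
            (not_le.mpr hlt)
        refine ⟨(((r i + 1 : ℕ) : ZMod p)⁻¹).val, ?_⟩
        have := congrArg (ZMod.castHom dvd_rfl A) (mul_inv_cancel₀ hne)
        rw [map_mul, map_one, map_natCast] at this
        rw [← this]
        congr 1
        rw [← map_natCast (ZMod.castHom dvd_rfl A), ZMod.natCast_zmod_val]
      refine AddSubgroup.subset_closure (Or.inr ⟨i.pos, Function.update χ.x i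
        (c ^ p * ((t : A) * (χ.x i * ∏ j, χ.x j ^ r j))), ?_⟩)
      refine Prod.ext (χ.coeff_injective ?_) (by simp)
      rw [coeff_dForm_update, deriv_pow_mul, Derivation.leibniz, Derivation.map_natCast,
        Derivation.leibniz, deriv_x, if_pos rfl, smul_eq_mul, smul_eq_mul, x_mul_deriv_monomial,
        map_smul, coeff_dForm_x]
      push_cast at ht
      simp only [smul_eq_mul, mul_zero, add_zero, mul_one]
      linear_combination (-c ^ p * ∏ j, χ.x j ^ r j) * ht

lemma isCartier_iff {η θ : Forms k A n} :
    IsCartier k p η θ ↔ χ.coeff θ = χ.cartier (χ.coeff η) := by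
  refine ⟨χ.coeff_eq_of_isCartier, fun h => ?_⟩
  have := χ.isCartier_smul_dForm (χ.coeff η)
  rwa [← h, coeff_smul_dForm, coeff_smul_dForm] at this


/-- The exponents `p - 1 - rᵢ + sᵢ` lie between `0` and `2p - 2`, where only `p - 1` is congruent to
`p - 1` mod `p`. -/
lemma cartier_monomial_mul {r s : Fin n → ℕ} (hr : ∀ i, r i < p) (hs : ∀ i, s i < p) :
    χ.cartier ((∏ i, χ.x i ^ (p - 1 - r i)) * ∏ i, χ.x i ^ s i) = if r = s then 1 else 0 := by
  rw [← Finset.prod_mul_distrib]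
  simp only [← pow_add]
  rw [cartier_monomial]
  by_cases h : r = s
  · subst h
    have hp : p.Prime := Fact.out
    have : ∀ i, p - 1 - r i + r i = p - 1 := fun i => by have := hr i; omega
    simp only [this]
    rw [if_pos fun i => Nat.mod_eq_of_lt (by have := hp.pos; omega), if_pos trivial]
    simp [Nat.div_eq_of_lt (show p - 1 < p by have := hp.pos; omega)]
  · rw [if_neg h, if_neg]
    intro hall
    apply h
    ext i
    have h1 := hr i
    have h2 := hs i
    have h3 := hall i
    by_cases h4 : p - 1 - r i + s i < p
    · rw [Nat.mod_eq_of_lt h4] at h3; omega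
    · rw [Nat.mod_eq_sub_mod (not_lt.mp h4), Nat.mod_eq_of_lt (by omega)] at h3; omega

/-- The Cartier operator computes the coefficients over `A^p`. This gives both nondegeneracy of the
pairing and the ideal estimate. -/
lemma sum_cartier (c : A) :
    ∑ r : Fin n → Fin p, χ.cartier ((∏ i, χ.x i ^ (p - 1 - r i)) * c) ^ p *
      ∏ i, χ.x i ^ (r i : ℕ) = c := by
  have hp : p.Prime := Fact.out
  induction c using χ.induction with
  | zero => simp [hp.ne_zero]
  | add a b ha hb =>
    simp only [mul_add, map_add, add_pow_char, add_mul, Finset.sum_add_distrib, ha, hb]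
  | monomial a s hs =>
    rw [Finset.sum_eq_single fun i => ⟨s i, hs i⟩]
    · rw [mul_left_comm, cartier_pow_mul, cartier_monomial_mul _ hs hs]
      simp
    · intro r _ hr
      rw [mul_left_comm, cartier_pow_mul, cartier_monomial_mul _ (fun i => (r i).2) hs, if_neg]
      · simp [hp.ne_zero]
      · rintro h
        exact hr (funext fun i => Fin.ext (congrFun h i))
    · simp

/-- The function `c` such that `C(f c dx₁ ∧ ⋯ ∧ dxₙ) = σ(f) dx₁ ∧ ⋯ ∧ dxₙ`. -/
def dual (σ : A → A) : A :=
  ∑ r : Fin n → Fin p, σ (∏ i, χ.x i ^ (p - 1 - r i)) ^ p * ∏ i, χ.x i ^ (r i : ℕ)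

lemma cartier_mul_dual (σ : A →+ A) (hσ : ∀ a b, σ (a ^ p * b) = a * σ b) (f : A) :
    χ.cartier (f * χ.dual (p := p) σ) = σ f := by
  have hp : p.Prime := Fact.out
  induction f using χ.induction with
  | zero => simp
  | add f g hf hg => simp [add_mul, hf, hg]
  | monomial a s hs =>
    rw [hσ, mul_assoc, cartier_pow_mul, dual, Finset.mul_sum, map_sum]
    congr 1
    have hs' : ∀ i, p - 1 - s i < p := fun i => by have := hp.pos; omega
    rw [Finset.sum_eq_single fun i => ⟨p - 1 - s i, hs' i⟩]
    · have : ∀ i, p - 1 - (p - 1 - s i) = s i := fun i => by have := hs i; omega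
      have h1 := χ.cartier_monomial_mul hs' hs'
      simp only [this] at h1 ⊢
      rw [mul_left_comm, cartier_pow_mul, h1]
      simp
    · intro r _ hr
      have h1 := χ.cartier_monomial_mul hs' (fun i => (r i).2)
      have : ∀ i, p - 1 - (p - 1 - s i) = s i := fun i => by have := hs i; omega
      simp only [this] at h1
      rw [mul_left_comm, cartier_pow_mul, h1, if_neg, mul_zero]
      rintro h
      exact hr (funext fun i => Fin.ext (congrFun h i).symm)
    · simp

/-- The pairing `(f, c) ↦ C(f c dx₁ ∧ ⋯ ∧ dxₙ)` is nondegenerate. -/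
lemma eq_of_cartier_mul_eq {c d : A} (h : ∀ f, χ.cartier (f * c) = χ.cartier (f * d)) : c = d := by
  rw [← χ.sum_cartier c, ← χ.sum_cartier d]
  simp only [h]

end Coordinates

end FrobSplit

/-! ### Germs of the section attached to a Frobenius-linear map -/

namespace FrobSplit

open Module

namespace Coordinates

variable {k : Type*} [CommRing k] {A : Type*} [CommRing A] [Algebra k A] {p n : ℕ}
  (χ : Coordinates k A p n)

/-- The element `c (dx₁ ∧ ⋯ ∧ dxₙ)^{1-p}` of `ω^{1-p}`. -/
def powOneSub (c : A) : PowOneSub k A p n :=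
  c • (MultilinearMap.mkPiAlgebra A (Fin (p - 1)) A).compLinearMap fun _ => χ.coeff

lemma powOneSub_apply (c : A) (w : Fin (p - 1) → Forms k A n) :
    χ.powOneSub c w = c * ∏ j, χ.coeff (w j) := by
  simp [powOneSub]

lemma powOneSub_eq (φ : PowOneSub k A p n) : χ.powOneSub (φ fun _ => dForm k χ.x) = φ := by
  ext w
  rw [powOneSub_apply]
  conv_rhs => rw [← funext fun j => χ.coeff_smul_dForm (w j), MultilinearMap.map_smul_univ]
  rw [smul_eq_mul, mul_comm]

lemma powOneSub_mem_smul_top {I : Ideal A} {c : A} (hc : c ∈ I) :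
    χ.powOneSub c ∈ I • (⊤ : Submodule A (PowOneSub k A p n)) :=
  Submodule.smul_mem_smul hc trivial

variable [CharP A p] [Fact p.Prime] [IsDomain A]

/-- Writing `w = u dx` and `φ = c (dx)^{1-p}`, `φ w^p` has coefficient `c u^p`, and `u` comes out of
the Cartier operator; so `w = dx` decides everything. The left side involves no coordinates, so the
right side does not depend on them. -/
lemma forall_isCartier_iff (σ : A →+ A) (hσ : ∀ a b, σ (a ^ p * b) = a * σ b)
    (φ : PowOneSub k A p n) :
    (∀ f w, IsCartier k p (f • φ.contract w) (σ f • w)) ↔ φ = χ.powOneSub (χ.dual (p := p) σ) := by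
  have hp : p.Prime := Fact.out
  constructor
  · intro h
    rw [← χ.powOneSub_eq φ]
    congr 1
    refine χ.eq_of_cartier_mul_eq fun f => ?_
    have := χ.isCartier_iff.mp (h f (dForm k χ.x))
    simp only [PowOneSub.contract, χ.coeff.map_smul, coeff_dForm_x, smul_eq_mul, mul_one] at this
    rw [cartier_mul_dual _ _ hσ, this]
  · rintro rfl f w
    rw [χ.isCartier_iff]
    simp only [PowOneSub.contract, χ.coeff.map_smul, powOneSub_apply, Finset.prod_const, Finset.card_univ, Fintype.card_fin, smul_eq_mul]
    have : f * (χ.dual (p := p) σ * χ.coeff w ^ (p - 1) * χ.coeff w) =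
        χ.coeff w ^ p * (f * χ.dual (p := p) σ) := by
      rw [mul_assoc (χ.dual _), ← pow_succ, Nat.sub_add_cancel hp.pos]; ring
    rw [this, cartier_pow_mul, cartier_mul_dual _ _ hσ, mul_comm]

/-- If `σ = C(- · c)` with a unit `c`, every ideal stable under `σ` is contained in its
`p`-th power. -/
lemma le_sq_of_isUnit_dual (σ : A →+ A) (hσ : ∀ a b, σ (a ^ p * b) = a * σ b)
    (hu : IsUnit (χ.dual (p := p) σ)) (I : Ideal A) (hI : ∀ a ∈ I, σ a ∈ I) : I ≤ I * I := by
  have hp : p.Prime := Fact.out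
  intro a ha
  obtain ⟨c, hc⟩ := hu
  -- Dividing by the unit `c` expresses `C(f a)` as `σ(f a c⁻¹)`.
  have hC : ∀ f, χ.cartier (f * a) ∈ I := by
    intro f
    have : χ.cartier (f * a) = σ (f * a * ↑c⁻¹) := by
      rw [← χ.cartier_mul_dual σ hσ, ← hc, mul_assoc, Units.inv_mul, mul_one]
    rw [this]
    exact hI _ (I.mul_mem_right _ (I.mul_mem_left _ ha))
  rw [← χ.sum_cartier a]
  refine sum_mem fun r _ => Ideal.mul_mem_right _ _ ?_
  rw [← pow_two]
  exact Ideal.pow_le_pow_right hp.two_le (Ideal.pow_mem_pow (hC _) p)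

end Coordinates

/-! ### Existence of coordinates on smooth algebras -/

section Existence

variable {k : Type*} {B : Type*} [CommRing B] {p n : ℕ}

/-- The additive monoid generated by the monomials `c^p x₁^{r₁} ⋯ xₙ^{rₙ}` with `rᵢ < p`. -/
abbrev monomialSpan (p : ℕ) {n : ℕ} (x : Fin n → B) : AddSubmonoid B := AddSubmonoid.closure
  {a | ∃ (c : B) (r : Fin n → ℕ), (∀ i, r i < p) ∧ a = c ^ p * ∏ i, x i ^ r i}

lemma pow_mul_prod_mem_monomialSpan (hp : p.Prime) (x : Fin n → B) (c : B) (m : Fin n → ℕ) :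
    c ^ p * ∏ i, x i ^ m i ∈ monomialSpan p x := by
  refine AddSubmonoid.subset_closure ⟨c * ∏ i, x i ^ (m i / p), fun i => m i % p,
    fun i => Nat.mod_lt _ hp.pos, ?_⟩
  rw [mul_pow, mul_assoc, ← Finset.prod_pow, ← Finset.prod_mul_distrib]
  congr 1
  refine Finset.prod_congr rfl fun i _ => ?_
  rw [← pow_mul, ← pow_add, mul_comm, Nat.div_add_mod]

lemma mul_mem_monomialSpan (hp : p.Prime) (x : Fin n → B) {a b : B} (ha : a ∈ monomialSpan p x)
    (hb : b ∈ monomialSpan p x) : a * b ∈ monomialSpan p x := by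
  induction ha, hb using AddSubmonoid.closure_induction₂ with
  | mem a b ha hb =>
    obtain ⟨c, r, _, rfl⟩ := ha
    obtain ⟨d, s, _, rfl⟩ := hb
    have : c ^ p * (∏ i, x i ^ r i) * (d ^ p * ∏ i, x i ^ s i) =
        (c * d) ^ p * ∏ i, x i ^ (r i + s i) := by
      simp only [pow_add, Finset.prod_mul_distrib, mul_pow]; ring
    rw [this]
    exact pow_mul_prod_mem_monomialSpan hp x _ _
  | zero_left => rw [zero_mul]; exact zero_mem _
  | zero_right => rw [mul_zero]; exact zero_mem _
  | add_left a b c _ _ _ h h' => rw [add_mul]; exact add_mem h h'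
  | add_right a b c _ _ _ h h' => rw [mul_add]; exact add_mem h h'

variable [Field k] [Algebra k B]

/-- A finite unramified extension of rings of characteristic `p` whose base contains all `p`-th
powers is surjective. -/
lemma algebraMap_surjective_of_pow_mem_range {R S : Type*} [CommRing R] [CommRing S] [Algebra R S]
    [CharP S p] (hp : p.Prime) [Module.Finite R S] [Subsingleton Ω[S⁄R]]
    (h : ∀ s : S, s ^ p ∈ (algebraMap R S).range) : Function.Surjective (algebraMap R S) := by
  classical
  have hexp : ExpChar (TensorProduct R S S) p := by
    have := ExpChar.prime (R := S) hp
    exact expChar_of_injective_ringHom (f := (Algebra.TensorProduct.includeLeft (R := R) (S := S)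
      (A := S) (B := S)).toRingHom) (Function.LeftInverse.injective
        (g := Algebra.TensorProduct.lmul' R (S := S)) fun s => by simp) p
  set I := KaehlerDifferential.ideal R S with hI
  have hsq : I * I = I := by
    have : Subsingleton I.Cotangent := inferInstanceAs (Subsingleton Ω[S⁄R])
    exact (Ideal.cotangent_subsingleton_iff I).mp this
  have hfg : I.FG := KaehlerDifferential.ideal_fg R S
  -- The generators `1 ⊗ s - s ⊗ 1` have zero `p`-th power because `s^p` comes from `R`. The
  -- diagonal ideal is thus nilpotent and, being idempotent, zero; a finite epimorphism is
  -- surjective.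
  have hnil : I ≤ nilradical _ := by
    rw [hI, ← KaehlerDifferential.span_range_eq_ideal, Ideal.span_le]
    rintro _ ⟨s, rfl⟩
    refine ⟨p, ?_⟩
    obtain ⟨r, hr⟩ := h s
    rw [sub_pow_expChar, Algebra.TensorProduct.tmul_pow, Algebra.TensorProduct.tmul_pow, one_pow,
      ← hr, Algebra.algebraMap_eq_smul_one, TensorProduct.smul_tmul, sub_self]
    rfl
  have hbot : I = ⊥ := by
    obtain ⟨m, hm⟩ := Ideal.FG.isNilpotent_iff_le_nilradical hfg |>.mpr hnil
    have hid : IsIdempotentElem I := hsq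
    rcases Nat.eq_zero_or_pos m with rfl | h0
    · rw [pow_zero, Ideal.one_eq_top] at hm
      exact le_bot_iff.mp (le_top.trans_eq hm)
    · rwa [hid.pow_eq h0.ne'] at hm
  rw [← Algebra.isEpi_iff_surjective_algebraMap_of_finite, Algebra.isEpi_iff_forall_one_tmul_eq]
  intro s
  have := KaehlerDifferential.one_smul_sub_smul_one_mem_ideal R s
  rw [← hI, hbot] at this
  exact sub_eq_zero.mp this

/-- Let `R` be generated over `k` by the `p`-th powers and the `xᵢ`. Then `B` is finite over `R`,
and unramified since the `dxᵢ` generate the differentials and vanish over `R`; hence `R = B`.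
Constants are `p`-th powers, so `R` lies in the monomial span. -/
lemma monomialSpan_eq_top [IsAlgClosed k] [CharP k p] (hp : p.Prime) [Nontrivial B]
    [Algebra.FiniteType k B] (x : Fin n → B)
    (hx : Submodule.span B (Set.range fun i => KaehlerDifferential.D k B (x i)) = ⊤) :
    monomialSpan p x = ⊤ := by
  have : CharP B p := charP_of_injective_algebraMap (algebraMap k B).injective p
  have : Fact p.Prime := ⟨hp⟩
  set R : Subalgebra k B := Algebra.adjoin k (Set.range (fun b : B => b ^ p) ∪ Set.range x) with hR
  have hpow : ∀ b : B, b ^ p ∈ R := fun b => Algebra.subset_adjoin (Or.inl ⟨b, rfl⟩)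
  have hD : ∀ b : B, KaehlerDifferential.D R B b = 0 := by
    set D' : Derivation k B Ω[B⁄R] := (KaehlerDifferential.D R B).restrictScalars k
    have hlift : D'.liftKaehlerDifferential = 0 := by
      refine LinearMap.ext_on hx ?_
      rintro _ ⟨i, rfl⟩
      rw [Derivation.liftKaehlerDifferential_comp_D, LinearMap.zero_apply]
      exact (KaehlerDifferential.D R B).map_algebraMap
        (⟨x i, Algebra.subset_adjoin (Or.inr ⟨i, rfl⟩)⟩ : R)
    intro b
    have := D'.liftKaehlerDifferential_comp_D b
    rw [hlift] at this
    exact this.symm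
  have : Subsingleton Ω[B⁄R] := by
    rw [← Submodule.subsingleton_iff B, ← subsingleton_iff_bot_eq_top,
      ← KaehlerDifferential.span_range_derivation, eq_comm, Submodule.span_eq_bot]
    rintro _ ⟨b, rfl⟩
    exact hD b
  have : Algebra.FiniteType R B := Algebra.FiniteType.of_restrictScalars_finiteType k R B
  have : Algebra.IsIntegral R B := ⟨fun b => by
    refine IsIntegral.of_pow hp.pos ?_
    exact isIntegral_algebraMap (x := (⟨b ^ p, hpow b⟩ : R))⟩
  have : Module.Finite R B := Algebra.IsIntegral.finite
  have hsurj := algebraMap_surjective_of_pow_mem_range (R := R) (S := B) hp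
    fun b => ⟨⟨b ^ p, hpow b⟩, rfl⟩
  rw [eq_top_iff]
  intro b _
  obtain ⟨⟨b, hb⟩, rfl⟩ := hsurj b
  change b ∈ monomialSpan p x
  have hmem : ∀ c : B, c ^ p ∈ monomialSpan p x := fun c => by
    simpa using pow_mul_prod_mem_monomialSpan hp x c 0
  induction hb using Algebra.adjoin_induction with
  | mem b hb =>
    rcases hb with ⟨c, rfl⟩ | ⟨i, rfl⟩
    · exact hmem c
    · simpa [Pi.single_apply, pow_ite] using pow_mul_prod_mem_monomialSpan hp x 1 (Pi.single i 1)
  | algebraMap a =>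
    obtain ⟨c, rfl⟩ := IsAlgClosed.exists_pow_nat_eq a hp.pos
    rw [map_pow]
    exact hmem _
  | add a b _ _ ha hb => exact add_mem (ha trivial) (hb trivial)
  | mul a b _ _ ha hb => exact mul_mem_monomialSpan hp x (ha trivial) (hb trivial)

/-- A standard smooth algebra over an algebraically closed field has coordinates. -/
lemma exists_coordinates [IsAlgClosed k] [CharP k p] (hp : p.Prime) [Nontrivial B]
    [Algebra.IsStandardSmoothOfRelativeDimension n k B] : Nonempty (Coordinates k B p n) := by
  have : Algebra.IsStandardSmooth k B :=
    Algebra.IsStandardSmoothOfRelativeDimension.isStandardSmooth n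
  obtain ⟨g, hg⟩ :=
    Algebra.IsStandardSmoothOfRelativeDimension.exists_etale_mvPolynomial n k B
  algebraize [g.toRingHom]
  have : Algebra.Etale (MvPolynomial (Fin n) k) B := hg
  have : IsScalarTower k (MvPolynomial (Fin n) k) B := .of_algebraMap_eq' g.comp_algebraMap.symm
  set b := ((KaehlerDifferential.mvPolynomialBasis k (Fin n)).baseChange B).map
    (KaehlerDifferential.tensorKaehlerEquivOfFormallyEtale k (MvPolynomial (Fin n) k) B) with hb
  set x : Fin n → B := fun i => algebraMap (MvPolynomial (Fin n) k) B (.X i) with hx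
  have hbx : ∀ i, b i = KaehlerDifferential.D k B (x i) := by
    intro i
    simp [hb, hx]
  refine ⟨⟨x, b, hbx, monomialSpan_eq_top (k := k) hp x ?_⟩⟩
  rw [← b.span_eq]
  congr 2
  exact funext fun i => (hbx i).symm

lemma exists_coordinates_of_isLocalization (hp : p.Prime) (χ : Coordinates k B p n) (M : Submonoid B)
    (A : Type*) [CommRing A] [Algebra k A] [Algebra B A] [IsScalarTower k B A] [CharP A p]
    [IsLocalization M A] :
    ∃ ψ : Coordinates k A p n, (∀ i, ψ.x i = algebraMap B A (χ.x i)) ∧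
      ∀ (j : Fin n) (b : B), ψ.deriv j (algebraMap B A b) = algebraMap B A (χ.deriv j b) := by
  have : Fact p.Prime := ⟨hp⟩
  set b := Basis.ofIsLocalizedModule A M (KaehlerDifferential.map k k B A) χ.basis with hb
  have hbx : ∀ i, b i = KaehlerDifferential.D k A (algebraMap B A (χ.x i)) := by
    intro i
    rw [hb, Basis.ofIsLocalizedModule_apply, χ.basis_apply, KaehlerDifferential.map_D]
  refine ⟨⟨fun i => algebraMap B A (χ.x i), b, hbx, ?_⟩, fun _ => rfl, fun j a => ?_⟩
  · rw [eq_top_iff]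
    rintro a -
    have key : ∀ (a : B) (t : A), t ^ p * algebraMap B A a ∈
        monomialSpan p fun i => algebraMap B A (χ.x i) := by
      intro a
      induction a using χ.induction with
      | zero => intro t; rw [map_zero, mul_zero]; exact zero_mem _
      | add a b ha hb => intro t; rw [map_add, mul_add]; exact add_mem (ha t) (hb t)
      | monomial c r hr =>
        intro t
        refine AddSubmonoid.subset_closure ⟨t * algebraMap B A c, r, hr, ?_⟩
        simp [mul_pow, mul_assoc]
    obtain ⟨⟨b, s⟩, hs⟩ := IsLocalization.surj M a
    have hu := IsLocalization.map_units A s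
    -- `b / s = (1 / s)^p · b s^{p-1}`: denominators can be made `p`-th powers.
    have : a = (↑hu.unit⁻¹ : A) ^ p * algebraMap B A (b * s ^ (p - 1)) := by
      apply (hu.pow p).mul_left_cancel
      rw [← mul_assoc, ← mul_pow, IsUnit.mul_val_inv, one_pow, one_mul, map_mul, map_pow, ← hs]
      conv_lhs => rw [← Nat.sub_add_cancel hp.pos, pow_succ]
      ring
    rw [this]
    exact key _ _
  · change b.coord j (KaehlerDifferential.D k A (algebraMap B A a)) = _
    have h1 := congrArg (KaehlerDifferential.map k k B A) (χ.D_eq_sum a)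
    rw [KaehlerDifferential.map_D] at h1
    rw [h1]
    have h2 : ∀ i, KaehlerDifferential.map k k B A (χ.basis i) = b i := fun i => by
      rw [hb, Basis.ofIsLocalizedModule_apply]
    simp [h2, Finsupp.single_apply, ← algebraMap_smul A]

end Existence

end FrobSplit

/-! ### Passage to stalks and gluing -/

namespace FrobSplit

section Geometry

open TopologicalSpace

variable {p n : ℕ} {X : Scheme.{u}}

lemma FrobHom.exists_stalk (σ : FrobHom p X) (x : X) :
    ∃ τ : X.presheaf.stalk x →+ X.presheaf.stalk x, ∀ (U : X.Opens) (hx : x ∈ U) (a : Γ(X, U)),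
      τ (X.presheaf.germ U x hx a) = X.presheaf.germ U x hx (σ.app U a) := by
  choose U hU s hs using fun a : X.presheaf.stalk x => X.presheaf.exists_germ_eq a
  have key : ∀ (V : X.Opens) (hx : x ∈ V) (a : Γ(X, V)) (W : X.Opens) (hx' : x ∈ W) (b : Γ(X, W)),
      X.presheaf.germ V x hx a = X.presheaf.germ W x hx' b →
      X.presheaf.germ V x hx (σ.app V a) = X.presheaf.germ W x hx' (σ.app W b) := by
    intro V hx a W hx' b h
    obtain ⟨T, hT, iV, iW, hres⟩ := X.presheaf.germ_eq x hx hx' a b h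
    have h1 := σ.app_map iV.le a
    have h2 := σ.app_map iW.le b
    rw [← X.presheaf.germ_res_apply iV x hT, ← X.presheaf.germ_res_apply iW x hT]
    congr 1
    have e1 : homOfLE iV.le = iV := rfl
    have e2 : homOfLE iW.le = iW := rfl
    rw [e1] at h1
    rw [e2] at h2
    exact h1.symm.trans ((congrArg (σ.app T) hres).trans h2)
  refine ⟨AddMonoidHom.mk' (fun a => X.presheaf.germ (U a) x (hU a) (σ.app (U a) (s a))) ?_, ?_⟩
  · intro a b
    have hm : x ∈ U a ⊓ U b := ⟨hU a, hU b⟩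
    have ha := X.presheaf.germ_res_apply (homOfLE inf_le_left) x hm (s a)
    have hb := X.presheaf.germ_res_apply (homOfLE inf_le_right) x hm (s b)
    rw [hs] at ha hb
    rw [key _ (hU (a + b)) _ _ hm (X.presheaf.map (homOfLE inf_le_left).op (s a) +
      X.presheaf.map (homOfLE inf_le_right).op (s b)) (by rw [hs, map_add, ha, hb]),
      map_add, map_add, key _ hm _ _ (hU a) (s a) (by rw [ha, hs]),
      key _ hm _ _ (hU b) (s b) (by rw [hb, hs])]
  · intro V hx a
    exact key _ _ _ _ _ _ (hs _)

/-- The map induced by an element of `Hom(F_* 𝒪_X, 𝒪_X)` on a local ring. -/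
def FrobHom.stalk (σ : FrobHom p X) (x : X) : X.presheaf.stalk x →+ X.presheaf.stalk x :=
  (σ.exists_stalk x).choose

lemma FrobHom.stalk_germ (σ : FrobHom p X) (x : X) (U : X.Opens) (hx : x ∈ U) (a : Γ(X, U)) :
    σ.stalk x (X.presheaf.germ U x hx a) = X.presheaf.germ U x hx (σ.app U a) :=
  (σ.exists_stalk x).choose_spec U hx a

lemma FrobHom.stalk_pow_mul (σ : FrobHom p X) (x : X) (a b : X.presheaf.stalk x) :
    σ.stalk x (a ^ p * b) = a * σ.stalk x b := by
  obtain ⟨U, hU, a, rfl⟩ := X.presheaf.exists_germ_eq a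
  obtain ⟨V, hV, b, rfl⟩ := X.presheaf.exists_germ_eq b
  have hm : x ∈ U ⊓ V := ⟨hU, hV⟩
  rw [← X.presheaf.germ_res_apply (homOfLE inf_le_left) x hm a,
    ← X.presheaf.germ_res_apply (homOfLE inf_le_right) x hm b, ← map_pow, ← map_mul, stalk_germ,
    σ.app_pow_mul, map_mul, stalk_germ]

variable {k : Type u} [Field k] [X.Over (Spec (.of k))]

/-- The `k`-algebra structure of the ring of functions on an open subset. -/
abbrev sectionsAlgebra (k : Type u) [Field k] [X.Over (Spec (.of k))] (V : X.Opens) :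
    Algebra k Γ(X, V) :=
  ((Scheme.ΓSpecIso (.of k)).inv ≫ (X ↘ Spec (.of k)).appLE ⊤ V le_top).hom.toAlgebra

lemma exists_isStandardSmooth (n : ℕ) [SmoothOfRelativeDimension n (X ↘ Spec (.of k))] {x : X}
    {U : X.Opens} (hx : x ∈ U) : ∃ V : X.Opens, IsAffineOpen V ∧ x ∈ V ∧ V ≤ U ∧
      letI := sectionsAlgebra k V
      Algebra.IsStandardSmoothOfRelativeDimension n k Γ(X, V) := by
  obtain ⟨W, hW, V, hV, hxV, e, h⟩ :=
    SmoothOfRelativeDimension.exists_isStandardSmoothOfRelativeDimension (n := n)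
      (f := X ↘ Spec (.of k)) x
  -- `Spec k` is a single point.
  obtain rfl : W = ⊤ := by
    rw [eq_top_iff]
    intro y _
    have hs : Subsingleton (Spec (.of k)) := inferInstanceAs (Subsingleton (PrimeSpectrum k))
    rw [hs.elim y ((X ↘ Spec (.of k)) x)]
    exact e hxV
  obtain ⟨f, hfU, hf⟩ := hV.exists_basicOpen_le ⟨x, hx⟩ hxV
  refine ⟨X.basicOpen f, hV.basicOpen f, hf, hfU, ?_⟩
  have h1 : ((X ↘ Spec (.of k)).appLE ⊤ (X.basicOpen f) le_top).hom =
      (algebraMap Γ(X, V) Γ(X, X.basicOpen f)).comp ((X ↘ Spec (.of k)).appLE ⊤ V e).hom := by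
    rw [RingHom.algebraMap_toAlgebra, ← CommRingCat.hom_comp, Scheme.Hom.appLE_map]
  have := hV.isLocalization_basicOpen f
  have h2 := (RingHom.isStandardSmoothOfRelativeDimension_stableUnderCompositionWithLocalizationAway
    n).right Γ(X, X.basicOpen f) f _ h
  rw [← h1] at h2
  exact RingHom.isStandardSmoothOfRelativeDimension_respectsIso.2 _
    (Scheme.ΓSpecIso (.of k)).symm.commRingCatIsoToRingEquiv h2

lemma stalkAlgebra_algebraMap (V : X.Opens) (x : X) (hx : x ∈ V) :
    letI := sectionsAlgebra k V
    algebraMap k (X.presheaf.stalk x) = (X.presheaf.germ V x hx).hom.comp (algebraMap k Γ(X, V)) := by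
  have h : (X ↘ Spec (.of k)).appTop ≫ X.presheaf.germ ⊤ x trivial =
      (X ↘ Spec (.of k)).appLE ⊤ V le_top ≫ X.presheaf.germ V x hx := by
    have h' : (X ↘ Spec (.of k)).appLE ⊤ V le_top =
        (X ↘ Spec (.of k)).appTop ≫ X.presheaf.map (homOfLE le_top).op := rfl
    rw [h', Category.assoc, X.presheaf.germ_res]
  rw [RingHom.algebraMap_toAlgebra, RingHom.algebraMap_toAlgebra, ← CommRingCat.hom_comp,
    Category.assoc, h]

lemma FrobHom.corresponds_iff (σ : FrobHom p X) (s : PowOneSubSection k X p n) :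
    σ.Corresponds s ↔ ∀ (x : X) (f : X.presheaf.stalk x) (w : Forms k (X.presheaf.stalk x) n),
      IsCartier k p (f • (s.germ x).contract w) (σ.stalk x f • w) := by
  constructor
  · intro h x f w
    obtain ⟨U, hU, f, rfl⟩ := X.presheaf.exists_germ_eq f
    rw [stalk_germ]
    exact h U x hU f w
  · intro h U x hx f w
    rw [← stalk_germ]
    exact h x _ w

lemma charP_stalk (k : Type u) [Field k] (p : ℕ) [CharP k p] [X.Over (Spec (.of k))] (x : X) :
    CharP (X.presheaf.stalk x) p :=
  charP_of_injective_algebraMap (algebraMap k (X.presheaf.stalk x)).injective p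

variable [IsAlgClosed k] [CharP k p]

/-- Coordinates exist locally: functions `tᵢ` on a neighbourhood whose germs are coordinates at all
of its points, with partial derivatives of functions being functions. -/
lemma exists_local_coordinates (hp : p.Prime) [IsIntegral X]
    [SmoothOfRelativeDimension n (X ↘ Spec (.of k))] {x : X} {U : X.Opens} (hx : x ∈ U) :
    ∃ V : X.Opens, x ∈ V ∧ V ≤ U ∧ ∃ (t : Fin n → Γ(X, V)) (δ : Fin n → Γ(X, V) → Γ(X, V)),
      ∀ (y : X) (hy : y ∈ V), ∃ χ : Coordinates k (X.presheaf.stalk y) p n,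
        (∀ i, χ.x i = X.presheaf.germ V y hy (t i)) ∧
        ∀ j b, χ.deriv j (X.presheaf.germ V y hy b) = X.presheaf.germ V y hy (δ j b) := by
  obtain ⟨V, hV, hxV, hVU, h⟩ := exists_isStandardSmooth (k := k) n hx
  let := sectionsAlgebra k V
  have : Nonempty V := ⟨⟨x, hxV⟩⟩
  obtain ⟨χ⟩ := exists_coordinates (k := k) (B := Γ(X, V)) (p := p) (n := n) hp
  refine ⟨V, hxV, hVU, χ.x, fun j => χ.deriv j, fun y hy => ?_⟩
  have := hV.isLocalization_stalk ⟨y, hy⟩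
  have := charP_stalk k p y
  let : Algebra Γ(X, V) (X.presheaf.stalk y) :=
    TopCat.Presheaf.algebra_section_stalk X.presheaf ⟨y, hy⟩
  have : IsScalarTower k Γ(X, V) (X.presheaf.stalk y) :=
    .of_algebraMap_eq' (stalkAlgebra_algebraMap V y hy)
  obtain ⟨ψ, h1, h2⟩ := exists_coordinates_of_isLocalization hp χ
    (hV.primeIdealOf ⟨y, hy⟩).asIdeal.primeCompl (X.presheaf.stalk y)
  exact ⟨ψ, h1, h2⟩

lemma nonempty_coordinates_stalk (hp : p.Prime) [IsIntegral X]
    [SmoothOfRelativeDimension n (X ↘ Spec (.of k))] (x : X) :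
    Nonempty (Coordinates k (X.presheaf.stalk x) p n) := by
  obtain ⟨V, hx, -, t, δ, h⟩ := exists_local_coordinates (k := k) (n := n) hp
    (show x ∈ (⊤ : X.Opens) from trivial)
  exact ⟨(h x hx).choose⟩

/-- A function can be constructed locally from its germs. -/
lemma exists_section_of_locally (U : X.Opens) (a : ∀ x : X, X.presheaf.stalk x)
    (h : ∀ x ∈ U, ∃ V : X.Opens, x ∈ V ∧ V ≤ U ∧ ∃ b : Γ(X, V), ∀ (y : X) (hy : y ∈ V),
      a y = X.presheaf.germ V y hy b) :
    ∃ b : Γ(X, U), ∀ (y : X) (hy : y ∈ U), a y = X.presheaf.germ U y hy b := by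
  choose V hxV hVU b hb using fun x : U => h x x.2
  obtain ⟨c, hc, -⟩ := X.sheaf.existsUnique_gluing' V U (fun x => homOfLE (hVU x))
    (fun x hx => Opens.mem_iSup.mpr ⟨⟨x, hx⟩, hxV _⟩) b (by
      intro x y
      refine TopCat.Presheaf.section_ext X.sheaf _ _ _ fun z hz => ?_
      erw [X.presheaf.germ_res_apply, X.presheaf.germ_res_apply]
      rw [← hb x z hz.1, ← hb y z hz.2])
  refine ⟨c, fun y hy => ?_⟩
  have h1 := hb ⟨y, hy⟩ y (hxV _)
  have h2 := hc ⟨y, hy⟩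
  rw [h1, ← h2]
  exact X.presheaf.germ_res_apply _ _ _ _

/-- Coordinates are chosen separately at each point; by `hind` the germ can be recomputed in
coordinates coming from one neighbourhood, where its values are germs of a single function: the dual
coefficient times Jacobian determinants. -/
lemma existsUnique_corresponds (hp : p.Prime) [IsIntegral X]
    [SmoothOfRelativeDimension n (X ↘ Spec (.of k))] (σ : FrobHom p X) :
    ∃! s : PowOneSubSection k X p n, σ.Corresponds s := by
  classical
  have : Fact p.Prime := ⟨hp⟩
  have := fun x : X => charP_stalk k p x
  let χ := fun x : X => (nonempty_coordinates_stalk (k := k) (n := n) hp x).some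
  have hiff := fun (x : X) (ψ : Coordinates k (X.presheaf.stalk x) p n) =>
    ψ.forall_isCartier_iff (σ.stalk x) (σ.stalk_pow_mul x)
  have hind : ∀ (x : X) (ψ : Coordinates k (X.presheaf.stalk x) p n),
      (χ x).powOneSub ((χ x).dual (p := p) (σ.stalk x)) =
        ψ.powOneSub (ψ.dual (p := p) (σ.stalk x)) := fun x ψ =>
    (hiff x ψ _).mp ((hiff x (χ x) _).mpr rfl)
  refine ⟨⟨fun x => (χ x).powOneSub ((χ x).dual (p := p) (σ.stalk x)), fun U g => ?_⟩, ?_, ?_⟩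
  · obtain ⟨b, hb⟩ := exists_section_of_locally U
      (fun x => if hx : x ∈ U then (χ x).powOneSub ((χ x).dual (p := p) (σ.stalk x))
        (fun j => dForm k fun i => X.presheaf.germ U x hx (g j i)) else 0) (by
      intro x hx
      obtain ⟨V, hxV, hVU, t, δ, h⟩ := exists_local_coordinates (k := k) (n := n) hp hx
      refine ⟨V, hxV, hVU, (∑ r : Fin n → Fin p, σ.app V (∏ i, t i ^ (p - 1 - r i)) ^ p *
        ∏ i, t i ^ (r i : ℕ)) * ∏ j, Matrix.det (Matrix.of fun i l =>
          δ l (X.presheaf.map (homOfLE hVU).op (g j i))), fun y hy => ?_⟩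
      obtain ⟨ψ, h1, h2⟩ := h y hy
      rw [dif_pos (hVU hy), hind y ψ, Coordinates.powOneSub_apply, map_mul, map_prod]
      congr 1
      · rw [Coordinates.dual, map_sum]
        refine Finset.sum_congr rfl fun r _ => ?_
        have e : ∀ q : Fin n → ℕ,
            ∏ i, ψ.x i ^ q i = X.presheaf.germ V y hy (∏ i, t i ^ q i) := fun q => by
          simp only [h1, map_prod, map_pow]
        rw [map_mul, map_pow, e fun i => p - 1 - r i, e fun i => r i, σ.stalk_germ]
      · refine Finset.prod_congr rfl fun j _ => ?_
        rw [Coordinates.coeff_dForm, RingHom.map_det]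
        congr 1
        ext i l
        simp only [Matrix.of_apply, Coordinates.grad, RingHom.mapMatrix_apply, Matrix.map_apply]
        rw [← h2 l, X.presheaf.germ_res_apply])
    exact ⟨b, fun x hx => by rw [← hb x hx, dif_pos hx]⟩
  · exact (σ.corresponds_iff _).mpr fun x => (hiff x (χ x) _).mpr rfl
  · intro s hs
    ext1
    funext x
    exact (hiff x (χ x) _).mp ((σ.corresponds_iff s).mp hs x)

end Geometry

/-! ### Ideals of closed subschemes on stalks -/

section ClosedSubscheme

variable {p : ℕ} {X Y : Scheme.{u}}

/-- A closed immersion into an integral scheme that is injective on the functions near some point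
is an isomorphism. -/
lemma isIso_of_stalkMap_injective [IsIntegral X] (i : Y ⟶ X) [IsClosedImmersion i] (y : Y)
    (h : Function.Injective (i.stalkMap y)) : IsIso i := by
  have hbij : Function.Bijective (i.stalkMap y) := ⟨h, i.stalkMap_surjective y⟩
  have : IsIso (i.stalkMap y) := (ConcreteCategory.isIso_iff_bijective _).mpr hbij
  -- The generic point comes from the spectrum of the local ring at `i y`, which is identified with
  -- that of `Y` at `y`.
  have hgen : genericPoint X ∈ Set.range i := by
    have hmem : genericPoint X ∈ Set.range (X.fromSpecStalk (i y)) := by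
      rw [Scheme.range_fromSpecStalk]
      exact genericPoint_specializes _
    obtain ⟨z, hz⟩ := hmem
    refine ⟨Y.fromSpecStalk y (inv (Spec.map (i.stalkMap y)) z), ?_⟩
    rw [← Scheme.Hom.comp_apply, ← Scheme.Hom.comp_apply,
      ← Scheme.SpecMap_stalkMap_fromSpecStalk, IsIso.inv_hom_id_assoc, hz]
  have hsurj : Surjective i := ⟨by
    rw [← Set.range_eq_univ, ← Set.top_eq_univ, eq_top_iff]
    intro x _
    exact (genericPoint_specializes x).mem_closed i.isClosedEmbedding.isClosed_range hgen⟩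
  exact isIso_of_isClosedImmersion_of_surjective i

lemma FrobHom.CompatiblySplits.stalk_mem_ker {σ : FrobHom p X} {i : Y ⟶ X} [IsClosedImmersion i]
    (h : σ.CompatiblySplits i) (y : Y) (a : X.presheaf.stalk (i y))
    (ha : i.stalkMap y a = 0) : i.stalkMap y (σ.stalk (i y) a) = 0 := by
  obtain ⟨U, hU, a, rfl⟩ := X.presheaf.exists_germ_eq a
  rw [Scheme.Hom.germ_stalkMap_apply] at ha
  obtain ⟨W, hW, iW, iW', hres⟩ := Y.presheaf.germ_eq (U := i ⁻¹ᵁ U) (V := i ⁻¹ᵁ U) y hU hU (i.app U a) 0 (by rw [ha, map_zero])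
  -- The open set of `Y` where the section vanishes is cut out by an open set of `X`, on which
  -- compatibility can be applied.
  obtain ⟨V, hV⟩ := i.isClosedEmbedding.isInducing.isOpen_iff.mp W.isOpen
  obtain ⟨hVo, hVW⟩ := hV
  set T : X.Opens := ⟨V, hVo⟩ ⊓ U with hT
  have hTW : i ⁻¹ᵁ T ≤ W := fun z hz => by
    have : z ∈ (W : Set Y) := by rw [← hVW]; exact hz.1
    exact this
  have hyT : i y ∈ T := ⟨by have : y ∈ (W : Set Y) := hW
                            rw [← hVW] at this; exact this, hU⟩
  have hTU : T ≤ U := inf_le_right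
  rw [← X.presheaf.germ_res_apply (homOfLE hTU) _ hyT a, σ.stalk_germ,
    Scheme.Hom.germ_stalkMap_apply, h T _ ?_, map_zero]
  have h1 : i.app T (X.presheaf.map (homOfLE hTU).op a) =
      Y.presheaf.map (homOfLE (i.preimage_mono hTU)).op (i.app U a) := by
    rw [← CommRingCat.comp_apply, ← CommRingCat.comp_apply]
    congr 2
    exact i.naturality (homOfLE hTU).op
  rw [h1]
  have h2 : (homOfLE (i.preimage_mono hTU)).op = iW.op ≫ (homOfLE hTW).op := rfl
  rw [h2, Y.presheaf.map_comp, CommRingCat.comp_apply, hres, map_zero, map_zero]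

end ClosedSubscheme

end FrobSplit

end

theorem proposition2p1 {k : Type u} [Field k] [IsAlgClosed k]
    (p : ℕ) (hp : p.Prime) [CharP k p] (n : ℕ)
    (X : Scheme.{u}) [X.Over (Spec (.of k))]
    [IsSeparated (X ↘ Spec (.of k))] [LocallyOfFiniteType (X ↘ Spec (.of k))]
    [QuasiCompact (X ↘ Spec (.of k))]
    [IsIntegral X] [SmoothOfRelativeDimension n (X ↘ Spec (.of k))]
    (σ : FrobSplit.FrobHom p X) (hσ : σ.IsSplitting) :
    (∃! s : FrobSplit.PowOneSubSection k X p n, σ.Corresponds s) ∧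
    ∀ s : FrobSplit.PowOneSubSection k X p n, σ.Corresponds s →
      ∀ (Y : Scheme.{u}) (i : Y ⟶ X) [IsClosedImmersion i], ¬ IsIso i →
        σ.CompatiblySplits i → Set.range i ⊆ s.zeroSet := by
  refine ⟨FrobSplit.existsUnique_corresponds hp σ, ?_⟩
  rintro s hs Y i _ hi hY _ ⟨y, rfl⟩
  have : Fact p.Prime := ⟨hp⟩
  have := FrobSplit.charP_stalk k p (i y)
  have : IsLocallyNoetherian X := LocallyOfFiniteType.isLocallyNoetherian (X ↘ Spec (.of k))
  obtain ⟨χ⟩ := FrobSplit.nonempty_coordinates_stalk (k := k) (n := n) hp (i y)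
  have hgerm := (χ.forall_isCartier_iff (σ.stalk (i y)) (σ.stalk_pow_mul (i y)) _).mp
    ((σ.corresponds_iff s).mp hs (i y))
  rw [FrobSplit.PowOneSubSection.zeroSet, Set.mem_ofPred_eq, hgerm]
  apply χ.powOneSub_mem_smul_top
  by_contra hc
  apply hi
  refine FrobSplit.isIso_of_stalkMap_injective i y ?_
  set I := RingHom.ker (i.stalkMap y).hom with hI
  have hle := χ.le_sq_of_isUnit_dual (σ.stalk (i y)) (σ.stalk_pow_mul (i y))
    (by simpa using hc) I fun a ha => hY.stalk_mem_ker y a ha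
  -- Nakayama's lemma: `I` is finitely generated and, as a proper ideal of a local ring, lies in the
  -- Jacobson radical.
  have hbot : I = ⊥ := Submodule.eq_bot_of_le_smul_of_le_jacobson_bot I I
    (IsNoetherian.noetherian I) hle
    ((IsLocalRing.le_maximalIdeal (RingHom.ker_ne_top _)).trans
      (IsLocalRing.jacobson_eq_maximalIdeal ⊥ bot_ne_top).ge)
  exact (RingHom.injective_iff_ker_eq_bot _).mpr hbot
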